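/- Let $K$ be a field and let $R=\bigoplus_{n\ge 0}R_n$ be a standard graded $K$-algebra of prime characteristic $p$; that is, $R_0=K$, $R=K[R_1]$ and $\dim_K R_1<\infty$. Put $\mathfrak m=\bigoplus_{n\ge 1}R_n$. For $e\ge 0$ let $R^{1/p^e}$ be the $R$-module whose elements are the symbols $x^{1/p^e}$ with $x\in R$, with the addition of $R$ and with $r\cdot x^{1/p^e}=(r^{p^e}x)^{1/p^e}$. Assume that $R$ is $F$-finite (the $R$-module $R^{1/p}$ is finitely generated) and $F$-pure (the $R$-linear map $R\to R^{1/p}$, $r\mapsto (r^p)^{1/p}$, stays injective after tensoring with any $R$-module). For a real number $\lambda\ge 0$ say that $(R,\mathfrak m^\lambda)$ is $F$-pure if for all $e\gg 0$ there is an element $f\in\mathfrak m^{\lfloor (p^e-1)\lambda\rfloor}$ such that the $R$-linear map $R\to R^{1/p^e}$ with $1\mapsto f^{1/p^e}$ splits, and let $$\operatorname{fpt}(R)=\sup\{\lambda\in\mathbb R_{\ge 0} \mid (R,\mathfrak m^\lambda)\text{ is }F\text{-pure}\}.$$ For $i\in\mathbb N$ let $H^i_{\mathfrak m}(R)$ be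 the $i$-th local cohomology module, that is, the $i$-th cohomology of the Čech complex on a finite family of homogeneous generators of $\mathfrak m$, with its induced $\mathbb Z$-grading (the choice of the family does not matter). Let $$a_i(R)=\max\{\alpha\in\mathbb Z\mid H^i_{\mathfrak m}(R)_\alpha\neq 0\}$$ if $H^i_{\mathfrak m}(R)\neq 0$, and $a_i(R)=-\infty$ if $H^i_{\mathfrak m}(R)=0$. Then $$\operatorname{fpt}(R)\le -a_i(R)\qquad\text{for every } i\in\mathbb N.$$ -/

import Mathlib

universe u v

noncomputable section

/-! ### Standard graded algebras -/

/-- `R = ⨁ 𝒜 n` is a standard graded `K`-algebra: `R₀ = K`, `R` is generated as a `K`-algebra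
by `R₁`, and `R₁` is finite-dimensional over `K`. -/
structure IsStandardGraded (K : Type v) {R : Type u} [Field K] [CommRing R] [Algebra K R]
    (𝒜 : ℕ → Submodule K R) [GradedAlgebra 𝒜] : Prop where
  injective_algebraMap : Function.Injective (algebraMap K R)
  degree_zero : ∀ r : R, r ∈ 𝒜 0 ↔ ∃ c : K, algebraMap K R c = r
  adjoin_degree_one : Algebra.adjoin K (𝒜 1 : Set R) = ⊤
  finite_degree_one : Module.Finite K (𝒜 1)

/-! ### The module of `p^e`-th roots, `F`-finiteness and `F`-purity -/

/-- The `R`-module `R^{1/p^e}`: it has the same additive structure as `R`, and scalar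
multiplication `r • x^{1/p^e} = (r^{p^e} x)^{1/p^e}`. -/
def FrobRoot (_p _e : ℕ) (R : Type u) : Type u := R

namespace FrobRoot

variable (p e : ℕ) {R : Type u} [CommRing R]

instance : AddCommGroup (FrobRoot p e R) := inferInstanceAs (AddCommGroup R)

instance [Fact p.Prime] [CharP R p] : Module R (FrobRoot p e R) :=
  Module.compHom R (iterateFrobenius R p e)

/-- The element `x^{1/p^e}` of `R^{1/p^e}`. -/
def root : R ≃+ FrobRoot p e R := AddEquiv.refl R

theorem smul_root [Fact p.Prime] [CharP R p] (r x : R) :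
    r • root p e x = root p e (r ^ p ^ e * x) := rfl

variable [Fact p.Prime] [CharP R p]

/-- The `R`-linear map `R → R^{1/p^e}` sending `1` to `x^{1/p^e}`. -/
def mulRoot (x : R) : R →ₗ[R] FrobRoot p e R :=
  LinearMap.toSpanSingleton R (FrobRoot p e R) (root p e x)

end FrobRoot

/-- `R` is `F`-finite: it is a finitely generated module over itself via the Frobenius. -/
def IsFFinite (p : ℕ) (R : Type u) [CommRing R] [Fact p.Prime] [CharP R p] : Prop :=
  Module.Finite R (FrobRoot p 1 R)

/-- `R` is `F`-pure: the Frobenius, seen as the `R`-linear map `R → R^{1/p}`, `r ↦ (r^p)^{1/p}`,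
stays injective after tensoring with any `R`-module. -/
def IsFPure (p : ℕ) (R : Type u) [CommRing R] [Fact p.Prime] [CharP R p] : Prop :=
  ∀ (M : Type u) [AddCommGroup M] [Module R M],
    Function.Injective ((FrobRoot.mulRoot p 1 (1 : R)).rTensor M)

/-! ### `F`-pure thresholds -/

/-- The pair `(R, I^t)` is `F`-pure: for all `e ≫ 0` there is `x ∈ I^{⌊(p^e - 1) t⌋}` such that
the `R`-linear map `R → R^{1/p^e}`, `1 ↦ x^{1/p^e}`, splits. -/
def IsFPurePair (p : ℕ) {R : Type u} [CommRing R] [Fact p.Prime] [CharP R p]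
    (I : Ideal R) (t : ℝ) : Prop :=
  ∀ᶠ e : ℕ in Filter.atTop, ∃ x ∈ I ^ ⌊((p : ℝ) ^ e - 1) * t⌋₊,
    ∃ φ : FrobRoot p e R →ₗ[R] R, φ ∘ₗ FrobRoot.mulRoot p e x = LinearMap.id

/-- The `F`-pure threshold `fpt(I)`, the supremum (in `[-∞, ∞]`) of the real numbers `t ≥ 0` such
that `(R, I^t)` is `F`-pure. -/
def fpt (p : ℕ) {R : Type u} [CommRing R] [Fact p.Prime] [CharP R p] (I : Ideal R) : EReal :=
  sSup ((fun t : ℝ => (t : EReal)) '' {t : ℝ | 0 ≤ t ∧ IsFPurePair p I t})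

/-! ### The Čech complex and local cohomology -/

namespace Cech

section Complex

variable {R : Type u} [CommRing R] {l : ℕ} (f : Fin l → R)

/-- The product `f_{σ 0} ⋯ f_{σ (i-1)}` for `σ 0 < ⋯ < σ (i-1)`. -/
def prodOf {i : ℕ} (σ : Fin i ↪o Fin l) : R := ∏ k, f (σ k)

/-- The `i`-th term of the Čech complex on `f`: the direct sum (a finite product) over
`j₁ < ⋯ < j_i` of the localizations of `R` at `f_{j₁} ⋯ f_{j_i}`. -/
abbrev Cochain (i : ℕ) : Type u :=
  ∀ σ : Fin i ↪o Fin l, Localization.Away (prodOf f σ)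

/-- The increasing tuple `σ` with its `k`-th entry left out. -/
def face {i : ℕ} (σ : Fin (i + 1) ↪o Fin l) (k : Fin (i + 1)) : Fin i ↪o Fin l :=
  (Fin.succAboveOrderEmb k).trans σ

theorem prodOf_eq {i : ℕ} (σ : Fin (i + 1) ↪o Fin l) (k : Fin (i + 1)) :
    prodOf f σ = f (σ k) * prodOf f (face σ k) :=
  Fin.prod_univ_succAbove _ k

theorem isUnit_face {i : ℕ} (σ : Fin (i + 1) ↪o Fin l) (k : Fin (i + 1)) :
    IsUnit (algebraMap R (Localization.Away (prodOf f σ)) (prodOf f (face σ k))) := by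
  refine isUnit_of_dvd_unit (map_dvd _ ?_)
    (IsLocalization.Away.algebraMap_isUnit (S := Localization.Away (prodOf f σ)) (prodOf f σ))
  exact ⟨f (σ k), (prodOf_eq f σ k).trans (mul_comm _ _)⟩

/-- The localization map from the localization at the product over a face of `σ` to the
localization at the product over `σ`. -/
def res {i : ℕ} (σ : Fin (i + 1) ↪o Fin l) (k : Fin (i + 1)) :
    Localization.Away (prodOf f (face σ k)) →ₐ[R] Localization.Away (prodOf f σ) :=
  { IsLocalization.Away.lift (prodOf f (face σ k)) (isUnit_face f σ k) with
    commutes' := fun r => IsLocalization.Away.lift_eq _ (isUnit_face f σ k) r }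

/-- The Čech differential `(d c)_σ = ∑ₖ (-1)^k c_{σ without its k-th entry}`. -/
def d (i : ℕ) : Cochain f i →ₗ[R] Cochain f (i + 1) :=
  LinearMap.pi fun σ => ∑ k : Fin (i + 1),
    ((-1 : R) ^ (k : ℕ)) • ((res f σ k).toLinearMap ∘ₗ LinearMap.proj (face σ k))

/-- The `i`-cocycles. -/
abbrev cocycles (i : ℕ) : Submodule R (Cochain f i) := LinearMap.ker (d f i)

/-- The `i`-coboundaries. -/
def coboundaries : (i : ℕ) → Submodule R (Cochain f i)
  | 0 => ⊥
  | i + 1 => LinearMap.range (d f i)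

/-- The `i`-th cohomology of the Čech complex on `f`, which is the local cohomology module
`H^i_I(R)` for the ideal `I` generated by `f`. -/
abbrev LocalCohomology (i : ℕ) : Type u :=
  cocycles f i ⧸ (coboundaries f i).submoduleOf (cocycles f i)

end Complex

section Grading

variable {K : Type v} {R : Type u} [Field K] [CommRing R] [Algebra K R]
  (𝒜 : ℕ → Submodule K R)

/-- The grading of `R` indexed by all integers, zero in negative degrees. -/
def intDegree : ℤ → Submodule K R
  | Int.ofNat a => 𝒜 a
  | Int.negSucc _ => ⊥

variable [GradedAlgebra 𝒜]

theorem mul_mem_intDegree {r s : R} {α : ℤ} {b : ℕ} (hr : r ∈ intDegree 𝒜 α) (hs : s ∈ 𝒜 b) :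
    r * s ∈ intDegree 𝒜 (α + b) := by
  cases α with
  | ofNat a => exact SetLike.mul_mem_graded (A := 𝒜) hr hs
  | negSucc a =>
    have h0 : r = 0 := hr
    simp [h0]

/-- The degree `α` part of the localization of `R` at a homogeneous element `g`: the fractions
`r / g^n` with `r` homogeneous and `deg r - deg g^n = α`. -/
def awayDegree (g : R) (α : ℤ) : AddSubgroup (Localization.Away g) where
  carrier := {x | ∃ (n b : ℕ) (r : R), g ^ n ∈ 𝒜 b ∧ r ∈ intDegree 𝒜 (α + b) ∧
    x * algebraMap R (Localization.Away g) (g ^ n) = algebraMap R (Localization.Away g) r}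
  zero_mem' := ⟨0, 0, 0, by simpa using SetLike.one_mem_graded 𝒜, zero_mem _, by simp⟩
  add_mem' := by
    rintro x y ⟨n, b, r, hn, hr, hx⟩ ⟨n', b', r', hn', hr', hy⟩
    refine ⟨n + n', b + b', r * g ^ n' + r' * g ^ n, ?_, ?_, ?_⟩
    · rw [pow_add]
      exact SetLike.mul_mem_graded hn hn'
    · refine add_mem ?_ ?_
      · have := mul_mem_intDegree 𝒜 hr hn'
        rwa [add_assoc, ← Nat.cast_add] at this
      · have := mul_mem_intDegree 𝒜 hr' hn
        rwa [add_assoc, ← Nat.cast_add, add_comm b' b] at this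
    · rw [pow_add, map_mul, map_add, map_mul, map_mul, ← hx, ← hy]
      ring
  neg_mem' := by
    rintro x ⟨n, b, r, hn, hr, hx⟩
    exact ⟨n, b, -r, hn, neg_mem hr, by rw [neg_mul, hx, map_neg]⟩

variable {l : ℕ} (f : Fin l → R)

/-- The cochains all of whose components are homogeneous of degree `α`. -/
def cochainDegree (i : ℕ) (α : ℤ) : AddSubgroup (Cochain f i) :=
  AddSubgroup.pi Set.univ fun σ => awayDegree 𝒜 (prodOf f σ) α

/-- The degree `α` part of the local cohomology module: the classes of the cocycles that are
homogeneous of degree `α`. -/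
def localCohomologyDegree (i : ℕ) (α : ℤ) : AddSubgroup (LocalCohomology f i) :=
  ((cochainDegree 𝒜 f i α).comap (cocycles f i).subtype.toAddMonoidHom).map
    ((coboundaries f i).submoduleOf (cocycles f i)).mkQ.toAddMonoidHom

/-- The `a_i`-invariant: the top degree in which the `i`-th local cohomology module is nonzero,
as a supremum in `[-∞, ∞]`; it is `-∞` if there is no such degree. -/
def aInvariant (i : ℕ) : EReal :=
  sSup ((fun α : ℤ => ((α : ℝ) : EReal)) '' {α : ℤ | localCohomologyDegree 𝒜 f i α ≠ ⊥})

end Grading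

end Cech

end

/-! ### The Čech complex: simplicial identities and cochains modulo an ideal. -/

noncomputable section

namespace Cech

section Complex

variable {R : Type u} [CommRing R] {l : ℕ} (f : Fin l → R)

/-! Write `q = p ^ e`. If `1 ↦ y^{1/q}` splits, the splitting `φ` is additive with `φ (a ^ q * z) =
a * φ z` and `φ y = 1`. It extends to every localization in the Čech complex, commutes with the
differential and sends `y • c ^ q` back to `c`. Hence `c ↦ y • c ^ q` carries nonzero cohomology
classes to nonzero classes (`mem_coboundaries_of_smul_powCochain_mem`).

Now let `a` be the top degree of `H^i` and `c` a cocycle of degree `a` with nonzero class. If `y ∈ m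
^ s`, then `y` is a sum of forms `z` of degree `n ≥ s`, and `z • c ^ q` has degree `q * a + n`. Were
`s > -(q - 1) * a`, all these degrees would exceed `a`, making `y • c ^ q` a coboundary. So `s ≤ -(q
- 1) * a` (`le_of_splitting`); take `s = ⌊(q - 1) t⌋` and let `e` grow.

A top degree exists because `H^i` vanishes in large degrees (`vanishesInLargeDegrees`). This is
Noetherian induction on homogeneous ideals `I`, for the cohomology of `R ⧸ I`, modelled by cochains
of `R` modulo those with components in `I`. A zerodivisor `f j ∉ I` modulo `I` reduces `I` to the
larger ideals `I + (f j)` and `I : f j`. For a nonzerodivisor, multiplication by `f j` is injective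
on cohomology in large degrees, while the cohomology is `f j`-power torsion. -/

theorem d_apply {i : ℕ} (c : Cochain f i) (σ : Fin (i + 1) ↪o Fin l) :
    d f i c σ = ∑ k : Fin (i + 1), (-1 : R) ^ (k : ℕ) • res f σ k (c (face σ k)) := by
  simp [d]

theorem face_apply {i : ℕ} (σ : Fin (i + 1) ↪o Fin l) (k : Fin (i + 1)) (m : Fin i) :
    face σ k m = σ (k.succAbove m) := rfl

theorem face_face {i : ℕ} (σ : Fin (i + 2) ↪o Fin l) (k : Fin (i + 2)) (m : Fin (i + 1)) :
    face (face σ (k.succAbove m)) (m.predAbove k) = face (face σ k) m := by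
  ext n
  simp only [face_apply, Fin.succAbove_succAbove_succAbove_predAbove]

/-- A family indexed by the codimension two faces has alternating sum zero. -/
theorem sum_face_face {i : ℕ} {M : Type*} [AddCommGroup M] [Module R M]
    (σ : Fin (i + 2) ↪o Fin l) (G : (Fin i ↪o Fin l) → M) :
    ∑ k : Fin (i + 2), ∑ m : Fin (i + 1),
      (-1 : R) ^ ((k : ℕ) + m) • G (face (face σ k) m) = 0 := by
  rw [← Fintype.sum_prod_type']
  -- Deleting the same two entries in the other order gives the same face with the opposite sign.
  refine Finset.sum_involution (fun x _ => (x.1.succAbove x.2, x.2.predAbove x.1)) ?_ ?_ ?_ ?_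
  · rintro ⟨k, m⟩ -
    simp only [face_face, Fin.neg_one_pow_succAbove_add_predAbove, neg_smul, add_neg_cancel]
  · rintro ⟨k, m⟩ - - h
    exact Fin.succAbove_ne k m (congrArg Prod.fst h)
  · simp
  · rintro ⟨k, m⟩ -
    refine Prod.ext (Fin.succAbove_succAbove_predAbove k m) ?_
    exact Fin.predAbove_predAbove_succAbove k m

/-- The component of a cochain at `τ`, seen in the localization at `prodOf f σ`; it is zero unless
`prodOf f τ` is invertible there. -/
def restrict {i j : ℕ} (c : Cochain f i) (σ : Fin j ↪o Fin l) (τ : Fin i ↪o Fin l) :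
    Localization.Away (prodOf f σ) :=
  open Classical in
  if h : IsUnit (algebraMap R (Localization.Away (prodOf f σ)) (prodOf f τ)) then
    IsLocalization.Away.lift (S := Localization.Away (prodOf f τ)) (prodOf f τ) h (c τ)
  else 0

/-- Localization maps over `R` are unique. The result depends only on the codimension two face, not
on the route to it, which is the form needed by `sum_face_face`. -/
theorem res_res_eq_restrict {i : ℕ} (c : Cochain f i) (σ : Fin (i + 2) ↪o Fin l)
    (k : Fin (i + 2)) (m : Fin (i + 1)) :
    res f σ k (res f (face σ k) m (c (face (face σ k) m)))
      = restrict f c σ (face (face σ k) m) := by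
  have h : IsUnit (algebraMap R (Localization.Away (prodOf f σ))
      (prodOf f (face (face σ k) m))) := by
    have := (isUnit_face f (face σ k) m).map (res f σ k)
    rwa [AlgHom.commutes] at this
  rw [restrict, dif_pos h]
  have : ((res f σ k).comp (res f (face σ k) m)).toRingHom =
      IsLocalization.Away.lift (S := Localization.Away (prodOf f (face (face σ k) m)))
        (prodOf f (face (face σ k) m)) h := by
    refine IsLocalization.ringHom_ext (Submonoid.powers (prodOf f (face (face σ k) m))) ?_
    ext r
    simp
  exact DFunLike.congr_fun this _

theorem d_d {i : ℕ} (c : Cochain f i) : d f (i + 1) (d f i c) = 0 := by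
  funext σ
  rw [d_apply]
  simp only [d_apply, map_sum, map_smul, Finset.smul_sum, res_res_eq_restrict, smul_smul, ← pow_add]
  exact sum_face_face σ _

/-! ### Cochains with components in an ideal -/

/-- The cochains all of whose components lie in the extension of `I`. -/
def idealCochain (I : Ideal R) (i : ℕ) : Submodule R (Cochain f i) :=
  Submodule.pi Set.univ fun σ =>
    (I.map (algebraMap R (Localization.Away (prodOf f σ)))).restrictScalars R

variable {f}

theorem mem_idealCochain {I : Ideal R} {i : ℕ} {c : Cochain f i} :
    c ∈ idealCochain f I i ↔
      ∀ σ, c σ ∈ I.map (algebraMap R (Localization.Away (prodOf f σ))) := by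
  simp [idealCochain]

theorem idealCochain_mono {I J : Ideal R} (h : I ≤ J) (i : ℕ) :
    idealCochain f I i ≤ idealCochain f J i := fun _ hc =>
  mem_idealCochain.2 fun σ => Ideal.map_mono h (mem_idealCochain.1 hc σ)

theorem res_mem_map {I : Ideal R} {i : ℕ} (σ : Fin (i + 1) ↪o Fin l) (k : Fin (i + 1))
    {x : Localization.Away (prodOf f (face σ k))} (hx : x ∈ I.map (algebraMap R _)) :
    res f σ k x ∈ I.map (algebraMap R (Localization.Away (prodOf f σ))) := by
  have h := Ideal.mem_map_of_mem (res f σ k).toRingHom hx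
  rwa [Ideal.map_map, AlgHom.toRingHom_eq_coe, AlgHom.comp_algebraMap] at h

theorem d_mem_idealCochain {I : Ideal R} {i : ℕ} {c : Cochain f i}
    (hc : c ∈ idealCochain f I i) : d f i c ∈ idealCochain f I (i + 1) := by
  refine mem_idealCochain.2 fun σ => ?_
  rw [d_apply]
  refine Ideal.sum_mem _ fun k _ => ?_
  rw [Algebra.smul_def]
  exact Ideal.mul_mem_left _ _ (res_mem_map σ k (mem_idealCochain.1 hc _))

end Complex

/-! ### Fractions and extended ideals in `R_g`. -/

section Away

variable {R : Type u} [CommRing R] {g : R}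

theorem exists_mul_pow_eq (x : Localization.Away g) :
    ∃ (n : ℕ) (r : R), x * algebraMap R (Localization.Away g) (g ^ n) = algebraMap R _ r :=
  ⟨_, _, IsLocalization.Away.sec_spec g x⟩

theorem algebraMap_eq_iff {r s : R} :
    algebraMap R (Localization.Away g) r = algebraMap R (Localization.Away g) s ↔
      ∃ m : ℕ, g ^ m * r = g ^ m * s := by
  rw [IsLocalization.eq_iff_exists (Submonoid.powers g)]
  exact ⟨fun ⟨⟨_, m, rfl⟩, h⟩ => ⟨m, h⟩, fun ⟨m, h⟩ => ⟨⟨_, m, rfl⟩, h⟩⟩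

theorem isUnit_algebraMap_pow (n : ℕ) : IsUnit (algebraMap R (Localization.Away g) (g ^ n)) := by
  rw [map_pow]
  exact (IsLocalization.Away.algebraMap_isUnit g).pow n

theorem mem_map_away_iff {I : Ideal R} {x : Localization.Away g} {n : ℕ} {r : R}
    (h : x * algebraMap R (Localization.Away g) (g ^ n) = algebraMap R _ r) :
    x ∈ I.map (algebraMap R (Localization.Away g)) ↔ ∃ m : ℕ, g ^ m * r ∈ I := by
  rw [← Ideal.mul_unit_mem_iff_mem _ (isUnit_algebraMap_pow n), h,
    IsLocalization.mem_map_algebraMap_iff (Submonoid.powers g)]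
  constructor
  · rintro ⟨⟨⟨a, ha⟩, ⟨_, m, rfl⟩⟩, hm⟩
    simp only [← map_mul] at hm
    obtain ⟨k, hk⟩ := algebraMap_eq_iff.1 hm
    refine ⟨k + m, ?_⟩
    have : g ^ (k + m) * r = g ^ k * a := by rw [← hk]; ring
    rw [this]
    exact I.mul_mem_left _ ha
  · rintro ⟨m, hm⟩
    exact ⟨⟨⟨_, hm⟩, ⟨_, m, rfl⟩⟩, by simp [mul_comm]⟩

end Away

end Cech

end

/-! ### Homogeneous fractions, and division by a form modulo a homogeneous ideal. -/

noncomputable section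

namespace Cech

section Grading

variable {K : Type v} {R : Type u} [Field K] [CommRing R] [Algebra K R]
  {𝒜 : ℕ → Submodule K R} [GradedAlgebra 𝒜]

omit [GradedAlgebra 𝒜] in
theorem mem_intDegree_natCast {n : ℕ} {r : R} : r ∈ intDegree 𝒜 (n : ℤ) ↔ r ∈ 𝒜 n := Iff.rfl

theorem mul_mem_intDegree' {r s : R} {α β : ℤ} {b : ℕ} (hr : r ∈ intDegree 𝒜 α) (hs : s ∈ 𝒜 b)
    (h : α + b = β) : s * r ∈ intDegree 𝒜 β := by
  rw [mul_comm, ← h]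
  exact mul_mem_intDegree 𝒜 hr hs

theorem mem_awayDegree_iff {g : R} {E : ℕ} (hg : g ∈ 𝒜 E) {α : ℤ} {x : Localization.Away g} :
    x ∈ awayDegree 𝒜 g α ↔ ∃ (n : ℕ) (r : R), r ∈ intDegree 𝒜 (α + (n * E : ℕ)) ∧
      x * algebraMap R (Localization.Away g) (g ^ n) = algebraMap R (Localization.Away g) r := by
  have hpow (n : ℕ) : g ^ n ∈ 𝒜 (n * E) := SetLike.pow_mem_graded n hg
  constructor
  · rintro ⟨n, b, r, hn, hr, hx⟩
    -- If `g ^ n = 0` its degree is not determined, but the localization is then zero and the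
    -- numerator `0` serves.
    by_cases h0 : g ^ n = 0
    · exact ⟨n, 0, zero_mem _, by simp [h0]⟩
    · obtain rfl := DirectSum.degree_eq_of_mem_mem 𝒜 hn (hpow n) h0
      exact ⟨n, r, hr, hx⟩
  · rintro ⟨n, r, hr, hx⟩
    exact ⟨n, _, r, hpow n, hr, hx⟩

/-- The denominator of a homogeneous fraction can be enlarged. -/
theorem exists_numerator_of_le {g : R} {E : ℕ} (hg : g ∈ 𝒜 E) {α : ℤ} {x : Localization.Away g}
    {n m : ℕ} (hnm : n ≤ m)
    (h : ∃ r ∈ intDegree 𝒜 (α + (n * E : ℕ)),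
      x * algebraMap R (Localization.Away g) (g ^ n) = algebraMap R (Localization.Away g) r) :
    ∃ r ∈ intDegree 𝒜 (α + (m * E : ℕ)),
      x * algebraMap R (Localization.Away g) (g ^ m) = algebraMap R (Localization.Away g) r := by
  obtain ⟨k, rfl⟩ := Nat.exists_eq_add_of_le hnm
  obtain ⟨r, hr, hx⟩ := h
  refine ⟨g ^ k * r, mul_mem_intDegree' hr (SetLike.pow_mem_graded k hg) ?_, ?_⟩
  · push_cast [smul_eq_mul]; ring
  · rw [pow_add, map_mul, ← mul_assoc, hx, map_mul, mul_comm]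

theorem algebraMap_mul_mem_awayDegree {g s : R} {b : ℕ} (hs : s ∈ 𝒜 b) {α : ℤ}
    {x : Localization.Away g} (hx : x ∈ awayDegree 𝒜 g α) :
    algebraMap R _ s * x ∈ awayDegree 𝒜 g (α + b) := by
  obtain ⟨n, e, r, hn, hr, hx⟩ := hx
  exact ⟨n, e, s * r, hn, mul_mem_intDegree' hr hs (by ring), by rw [mul_assoc, hx, map_mul]⟩

/-- The homogeneous division step modulo a homogeneous ideal. -/
theorem exists_sub_mul_mem {I : Ideal R} (hI : I.IsHomogeneous 𝒜) {x : R} {b : ℕ} (hx : x ∈ 𝒜 b)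
    {β : ℤ} {r : R} (hr : r ∈ intDegree 𝒜 β) (h : r ∈ I ⊔ Ideal.span {x}) :
    ∃ s ∈ intDegree 𝒜 (β - b), r - x * s ∈ I := by
  cases β with
  | negSucc a =>
    obtain rfl : r = 0 := hr
    exact ⟨0, zero_mem _, by simp⟩
  | ofNat a =>
    obtain ⟨y, hy, z, hz, rfl⟩ := Submodule.mem_sup.1 h
    obtain ⟨t, rfl⟩ := Ideal.mem_span_singleton'.1 hz
    -- Compare components of degree `a`: that of `y` stays in `I`, and that of `t * x` is `t_{a-b} *
    -- x`, or `0` if `a < b`.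
    have hcomp := DirectSum.decompose_of_mem_same 𝒜 (show y + t * x ∈ 𝒜 a from hr)
    rw [DirectSum.decompose_add, DirectSum.add_apply, Submodule.coe_add] at hcomp
    by_cases hba : b ≤ a
    · rw [DirectSum.coe_decompose_mul_of_right_mem_of_le 𝒜 hx hba] at hcomp
      refine ⟨DirectSum.decompose 𝒜 t (a - b), ?_, ?_⟩
      · rw [show (Int.ofNat a - b : ℤ) = ((a - b : ℕ) : ℤ) by simp; omega]
        exact mem_intDegree_natCast.2 (SetLike.coe_mem _)
      · rw [← hcomp, mul_comm x, add_sub_cancel_right]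
        exact hI a hy
    · rw [DirectSum.coe_decompose_mul_of_right_mem_of_not_le 𝒜 hx hba, add_zero] at hcomp
      refine ⟨0, zero_mem _, ?_⟩
      rw [mul_zero, sub_zero, ← hcomp]
      exact hI a hy

theorem isHomogeneous_colon {I : Ideal R} (hI : I.IsHomogeneous 𝒜) {x : R} {b : ℕ}
    (hx : x ∈ 𝒜 b) : (I.colon {x}).IsHomogeneous 𝒜 := by
  intro n y hy
  rw [Submodule.mem_colon_singleton, smul_eq_mul] at hy ⊢
  have := hI (n + b) hy
  rwa [DirectSum.coe_decompose_mul_add_of_right_mem 𝒜 hx] at this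

variable {l : ℕ} {f : Fin l → R}

theorem mem_cochainDegree {i : ℕ} {α : ℤ} {c : Cochain f i} :
    c ∈ cochainDegree 𝒜 f i α ↔ ∀ σ, c σ ∈ awayDegree 𝒜 (prodOf f σ) α := by
  simp [cochainDegree, AddSubgroup.mem_pi]

theorem smul_mem_cochainDegree {i : ℕ} {α : ℤ} {c : Cochain f i} (hc : c ∈ cochainDegree 𝒜 f i α)
    {s : R} {b : ℕ} (hs : s ∈ 𝒜 b) : s • c ∈ cochainDegree 𝒜 f i (α + b) := by
  refine mem_cochainDegree.2 fun σ => ?_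
  rw [Pi.smul_apply, Algebra.smul_def]
  exact algebraMap_mul_mem_awayDegree hs (mem_cochainDegree.1 hc σ)

variable {D : Fin l → ℕ} (hD : ∀ j, f j ∈ 𝒜 (D j))

include hD

theorem prodOf_mem {i : ℕ} (σ : Fin i ↪o Fin l) : prodOf f σ ∈ 𝒜 (∑ k, D (σ k)) :=
  SetLike.prod_mem_graded _ _ _ fun k _ => hD (σ k)

theorem res_mem_awayDegree {i : ℕ} (σ : Fin (i + 1) ↪o Fin l) (k : Fin (i + 1)) {α : ℤ}
    {x : Localization.Away (prodOf f (face σ k))} (hx : x ∈ awayDegree 𝒜 (prodOf f (face σ k)) α) :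
    res f σ k x ∈ awayDegree 𝒜 (prodOf f σ) α := by
  obtain ⟨n, e, r, hn, hr, hx⟩ := hx
  have hf : f (σ k) ^ n ∈ 𝒜 (n * D (σ k)) := SetLike.pow_mem_graded n (hD _)
  refine ⟨n, n * D (σ k) + e, f (σ k) ^ n * r, ?_, mul_mem_intDegree' hr hf (by push_cast; ring), ?_⟩
  · rw [prodOf_eq f σ k, mul_pow]
    exact SetLike.mul_mem_graded hf hn
  · have hp : prodOf f σ ^ n = f (σ k) ^ n * prodOf f (face σ k) ^ n := by
      rw [prodOf_eq f σ k, mul_pow]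
    rw [hp, map_mul, map_mul]
    have := congrArg (res f σ k) hx
    rw [map_mul, AlgHom.commutes, AlgHom.commutes] at this
    rw [← this]; ring

theorem d_mem_cochainDegree {i : ℕ} {α : ℤ} {c : Cochain f i} (hc : c ∈ cochainDegree 𝒜 f i α) :
    d f i c ∈ cochainDegree 𝒜 f (i + 1) α := by
  refine mem_cochainDegree.2 fun σ => ?_
  rw [d_apply]
  refine AddSubgroup.sum_mem _ fun k _ => ?_
  have := res_mem_awayDegree hD σ k (mem_cochainDegree.1 hc _)
  rcases neg_one_pow_eq_or R (k : ℕ) with h | h <;> rw [h]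
  · simpa using this
  · simpa using this

/-- Homogeneous cochains of a given degree have a common denominator exponent. -/
theorem exists_common_denominator {i : ℕ} {α : ℤ} {c : Cochain f i}
    (hc : c ∈ cochainDegree 𝒜 f i α) :
    ∃ (n : ℕ) (r : (Fin i ↪o Fin l) → R), ∀ σ,
      r σ ∈ intDegree 𝒜 (α + (n * ∑ k, D (σ k) : ℕ)) ∧
      c σ * algebraMap R (Localization.Away (prodOf f σ)) (prodOf f σ ^ n) = algebraMap R _ (r σ) := by
  have h σ := (mem_awayDegree_iff (prodOf_mem hD σ)).1 (mem_cochainDegree.1 hc σ)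
  choose n r hr hx using h
  choose r' hr' hx' using fun σ => exists_numerator_of_le (prodOf_mem hD σ)
    (Finset.le_sup (f := n) (Finset.mem_univ σ)) ⟨r σ, hr σ, hx σ⟩
  exact ⟨_, r', fun σ => ⟨hr' σ, hx' σ⟩⟩

/-- A homogeneous cochain with components in `I + (x)` is divisible by `x` modulo `I`. -/
theorem exists_sub_smul_mem {I : Ideal R} (hI : I.IsHomogeneous 𝒜) {x : R} {b : ℕ} (hx : x ∈ 𝒜 b)
    {i : ℕ} {α : ℤ} {c : Cochain f i} (hc : c ∈ cochainDegree 𝒜 f i α)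
    (h : c ∈ idealCochain f (I ⊔ Ideal.span {x}) i) :
    ∃ c' ∈ cochainDegree 𝒜 f i (α - b), c - x • c' ∈ idealCochain f I i := by
  suffices H : ∀ σ, ∃ y ∈ awayDegree 𝒜 (prodOf f σ) (α - b),
      c σ - x • y ∈ I.map (algebraMap R (Localization.Away (prodOf f σ))) by
    choose y hy hy' using H
    exact ⟨y, mem_cochainDegree.2 hy, mem_idealCochain.2 hy'⟩
  intro σ
  have hg := prodOf_mem hD σ
  set g := prodOf f σ
  set E := ∑ k, D (σ k)
  obtain ⟨n, r, hr, hn⟩ := (mem_awayDegree_iff hg).1 (mem_cochainDegree.1 hc σ)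
  obtain ⟨m, hm⟩ := (mem_map_away_iff hn).1 (mem_idealCochain.1 h σ)
  have hgm : g ^ m ∈ 𝒜 (m * E) := SetLike.pow_mem_graded m hg
  obtain ⟨s, hs, hrs⟩ := exists_sub_mul_mem hI hx (mul_mem_intDegree' hr hgm rfl) hm
  have hu := isUnit_algebraMap_pow (g := g) (m + n)
  obtain ⟨y, hy⟩ : ∃ y, y * algebraMap R (Localization.Away g) (g ^ (m + n)) = algebraMap R _ s :=
    ⟨algebraMap R _ s * hu.unit⁻¹, by simp [mul_assoc]⟩
  refine ⟨y, (mem_awayDegree_iff hg).2 ⟨m + n, s, ?_, hy⟩, ?_⟩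
  · convert hs using 2
    push_cast; ring
  · rw [← Ideal.mul_unit_mem_iff_mem _ hu, Algebra.smul_def, sub_mul, mul_assoc, hy, pow_add,
      map_mul, mul_left_comm, hn, ← map_mul, ← map_mul, ← map_sub]
    exact Ideal.mem_map_of_mem _ hrs

omit hD

/-- Forming the colon by an element commutes with localization. This is how the kernel of
multiplication by `x` on cochains of `R ⧸ I` is read off. -/
theorem smul_mem_idealCochain_iff {I : Ideal R} {x : R} {i : ℕ} {c : Cochain f i} :
    x • c ∈ idealCochain f I i ↔ c ∈ idealCochain f (I.colon {x}) i := by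
  rw [mem_idealCochain, mem_idealCochain]
  refine forall_congr' fun σ => ?_
  obtain ⟨n, r, hr⟩ := exists_mul_pow_eq (c σ)
  have hr' : (x • c) σ * algebraMap R (Localization.Away (prodOf f σ)) (prodOf f σ ^ n) =
      algebraMap R _ (r * x) := by
    rw [Pi.smul_apply, Algebra.smul_def, mul_assoc, hr, map_mul, mul_comm]
  rw [mem_map_away_iff hr, mem_map_away_iff hr']
  simp only [Submodule.mem_colon_singleton, smul_eq_mul, mul_assoc]

end Grading

end Cech

end

/-! ### Cohomology modulo an ideal is `f j`-power torsion. -/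

noncomputable section

namespace Cech

section Faces

variable {l : ℕ}

theorem range_eq_insert_range_face {i : ℕ} (σ : Fin (i + 1) ↪o Fin l) (k : Fin (i + 1)) :
    Set.range σ = insert (σ k) (Set.range (face σ k)) := by
  ext a
  simp only [Set.mem_range, Set.mem_insert_iff, face_apply]
  rw [Fin.exists_iff_succAbove k]
  simp [eq_comm]

theorem mem_range_face {i : ℕ} (σ : Fin (i + 1) ↪o Fin l) {k m : Fin (i + 1)} (h : m ≠ k) :
    σ k ∈ Set.range (face σ m) := by
  obtain ⟨n, rfl⟩ := Fin.exists_succAbove_eq h.symm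
  exact ⟨n, rfl⟩

theorem apply_notMem_range_face {i : ℕ} (σ : Fin (i + 1) ↪o Fin l) (k : Fin (i + 1)) :
    σ k ∉ Set.range (face σ k) := by
  rintro ⟨n, hn⟩
  exact Fin.succAbove_ne k n (σ.injective hn)

theorem eq_of_face_eq {i : ℕ} {σ σ' : Fin (i + 1) ↪o Fin l} {k k' : Fin (i + 1)}
    (h : face σ k = face σ' k') (hk : σ k = σ' k') : σ = σ' ∧ k = k' := by
  have : σ = σ' := by
    rw [← OrderEmbedding.range_inj, range_eq_insert_range_face σ k,
      range_eq_insert_range_face σ' k', h, hk]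
  subst this
  exact ⟨rfl, σ.injective hk⟩

theorem exists_face_eq {i : ℕ} {τ : Fin i ↪o Fin l} {j : Fin l} (hj : j ∉ Set.range τ) :
    ∃ (σ : Fin (i + 1) ↪o Fin l) (k : Fin (i + 1)), face σ k = τ ∧ σ k = j := by
  set s : Finset (Fin l) := insert j (Finset.univ.map τ.toEmbedding)
  have hs : s.card = i + 1 := by
    rw [Finset.card_insert_of_notMem (by simpa using hj)]
    simp
  have hr : Set.range (s.orderEmbOfFin hs) = insert j (Set.range τ) := by
    simp [s]
  obtain ⟨k, hk⟩ : j ∈ Set.range (s.orderEmbOfFin hs) := hr ▸ Set.mem_insert _ _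
  refine ⟨s.orderEmbOfFin hs, k, ?_, hk⟩
  rw [← OrderEmbedding.range_inj]
  rw [range_eq_insert_range_face _ k, hk] at hr
  have h1 : j ∉ Set.range (face (s.orderEmbOfFin hs) k) := by
    conv => rw [← hk]
    exact apply_notMem_range_face _ k
  rw [← Set.insert_sdiff_self_of_notMem h1, hr, Set.insert_sdiff_self_of_notMem hj]

end Faces

section Grading

variable {K : Type v} {R : Type u} [Field K] [CommRing R] [Algebra K R]
  (𝒜 : ℕ → Submodule K R) [GradedAlgebra 𝒜] {l : ℕ} (f : Fin l → R)

/-- The coboundaries of homogeneous cochains of degree `α`. -/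
def coboundaryDegree : (i : ℕ) → ℤ → AddSubgroup (Cochain f i)
  | 0, _ => ⊥
  | i + 1, α => (cochainDegree 𝒜 f i α).map (d f i).toAddMonoidHom

variable {𝒜 f}

theorem mem_coboundaries_of_mem_coboundaryDegree {i : ℕ} {α : ℤ} {b : Cochain f i}
    (hb : b ∈ coboundaryDegree 𝒜 f i α) : b ∈ coboundaries f i := by
  cases i with
  | zero => exact hb
  | succ i =>
    obtain ⟨c, -, rfl⟩ := hb
    exact ⟨c, rfl⟩

theorem d_eq_zero_of_mem_coboundaryDegree {i : ℕ} {α : ℤ} {b : Cochain f i}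
    (hb : b ∈ coboundaryDegree 𝒜 f i α) : d f i b = 0 := by
  cases i with
  | zero => rw [show b = 0 from hb, map_zero]
  | succ i =>
    obtain ⟨c, -, rfl⟩ := hb
    exact d_d f c

theorem smul_mem_coboundaryDegree {i : ℕ} {α β : ℤ} {b : Cochain f i}
    (hb : b ∈ coboundaryDegree 𝒜 f i α) {s : R} {n : ℕ} (hs : s ∈ 𝒜 n) (h : α + n = β) :
    s • b ∈ coboundaryDegree 𝒜 f i β := by
  subst h
  cases i with
  | zero =>
    rw [show b = 0 from hb, smul_zero]
    exact zero_mem _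
  | succ i =>
    obtain ⟨c, hc, rfl⟩ := hb
    exact ⟨s • c, smul_mem_cochainDegree hc hs, map_smul (d f i) s c⟩

variable {D : Fin l → ℕ} (hD : ∀ j, f j ∈ 𝒜 (D j))

include hD

theorem mem_cochainDegree_of_mem_coboundaryDegree {i : ℕ} {α : ℤ} {b : Cochain f i}
    (hb : b ∈ coboundaryDegree 𝒜 f i α) : b ∈ cochainDegree 𝒜 f i α := by
  cases i with
  | zero => rw [show b = 0 from hb]; exact zero_mem _
  | succ i =>
    obtain ⟨c, hc, rfl⟩ := hb
    exact d_mem_cochainDegree hD hc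

/-- Up to a coboundary, a power of `f j` kills the components of a cochain that involve `j`. -/
theorem exists_coboundary_eq_at {i : ℕ} {α : ℤ} {c : Cochain f i}
    (hc : c ∈ cochainDegree 𝒜 f i α) (j : Fin l) :
    ∃ (n : ℕ), ∃ b ∈ coboundaryDegree 𝒜 f i (α + (n * D j : ℕ)),
      ∀ σ : Fin i ↪o Fin l, j ∈ Set.range σ → (f j ^ n • c) σ = b σ := by
  cases i with
  | zero =>
    refine ⟨0, 0, zero_mem _, ?_⟩
    rintro σ ⟨k, -⟩
    exact k.elim0
  | succ i =>
    obtain ⟨n, r, hr⟩ := exists_common_denominator hD hc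
    -- The contracting homotopy: with `c_σ = r_σ / g_σ ^ n` and `σ = τ ∪ {j}`, the factor `f j ^ n`
    -- cancels `j` from the denominator, so `b_τ = ± r_σ / g_τ ^ n` makes sense over `τ`. It is set
    -- to zero when `j ∈ τ`.
    have key : ∀ τ : Fin i ↪o Fin l, ∃ y ∈ awayDegree 𝒜 (prodOf f τ) (α + (n * D j : ℕ)),
        (j ∈ Set.range τ → y = 0) ∧ ∀ (σ : Fin (i + 1) ↪o Fin l) (k : Fin (i + 1)),
          face σ k = τ → σ k = j → y * algebraMap R (Localization.Away (prodOf f τ))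
            (prodOf f τ ^ n) = algebraMap R _ ((-1) ^ (k : ℕ) * r σ) := by
      intro τ
      by_cases hj : j ∈ Set.range τ
      · refine ⟨0, zero_mem _, fun _ => rfl, ?_⟩
        rintro σ k rfl rfl
        exact (apply_notMem_range_face σ k hj).elim
      · obtain ⟨σ, k, rfl, rfl⟩ := exists_face_eq hj
        have hu := isUnit_algebraMap_pow (g := prodOf f (face σ k)) n
        obtain ⟨y, hy⟩ : ∃ y, y * algebraMap R (Localization.Away (prodOf f (face σ k)))
            (prodOf f (face σ k) ^ n) = algebraMap R _ ((-1) ^ (k : ℕ) * r σ) :=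
          ⟨algebraMap R _ ((-1) ^ (k : ℕ) * r σ) * hu.unit⁻¹, by simp [mul_assoc]⟩
        refine ⟨y, ?_, fun h => (hj h).elim, ?_⟩
        · refine (mem_awayDegree_iff (prodOf_mem hD _)).2 ⟨n, _, ?_, hy⟩
          have h1 := (hr σ).1
          rw [Fin.sum_univ_succAbove _ k] at h1
          have h2 : (α + (n * D (σ k) : ℕ)) + (n * ∑ m, D (face σ k m) : ℕ) =
              α + (n * (D (σ k) + ∑ m, D (σ (k.succAbove m))) : ℕ) := by
            simp only [face_apply]; push_cast; ring
          rw [h2]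
          rcases neg_one_pow_eq_or R (k : ℕ) with h | h <;> rw [h]
          · simpa using h1
          · simpa using h1
        · intro σ' k' h1 h2
          obtain ⟨rfl, rfl⟩ := eq_of_face_eq h1 h2
          exact hy
    choose b hb hb0 hb1 using key
    refine ⟨n, d f i b, ⟨b, mem_cochainDegree.2 hb, rfl⟩, ?_⟩
    rintro σ ⟨k, rfl⟩
    -- Every other face still contains `j`, where `b` vanishes; in the surviving term the two signs
    -- cancel.
    rw [d_apply, Finset.sum_eq_single k]
    · have h := congrArg (res f σ k) (hb1 _ σ k rfl rfl)
      have hu : IsUnit (algebraMap R (Localization.Away (prodOf f σ)) (prodOf f (face σ k) ^ n)) := by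
        rw [map_pow]
        exact (isUnit_face f σ k).pow n
      have hp : prodOf f σ ^ n = f (σ k) ^ n * prodOf f (face σ k) ^ n := by
        rw [prodOf_eq f σ k, mul_pow]
      have h3 := (hr σ).2
      rw [map_mul, AlgHom.commutes, AlgHom.commutes, map_mul] at h
      rw [hp, map_mul] at h3
      rw [← hu.mul_left_inj, Pi.smul_apply, Algebra.smul_def, Algebra.smul_def,
        mul_assoc (algebraMap R _ ((-1) ^ (k : ℕ))), h, ← mul_assoc (algebraMap R _ _), ← map_mul,
        ← pow_add, Even.neg_one_pow ⟨_, rfl⟩, map_one, one_mul, ← h3]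
      ring
    · intro m _ hm
      rw [hb0 _ (mem_range_face σ hm), map_zero, smul_zero]
    · simp

omit hD

/-- A cocycle modulo `I` whose components involving `j` vanish modulo `I` is killed modulo `I` by a
power of `f j`. -/
theorem exists_pow_smul_mem_idealCochain {I : Ideal R} {i : ℕ} {c : Cochain f i} (j : Fin l)
    (hc : d f i c ∈ idealCochain f I (i + 1))
    (h0 : ∀ σ : Fin i ↪o Fin l, j ∈ Set.range σ →
      c σ ∈ I.map (algebraMap R (Localization.Away (prodOf f σ)))) :
    ∃ n : ℕ, f j ^ n • c ∈ idealCochain f I i := by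
  have key : ∀ τ : Fin i ↪o Fin l, ∃ n : ℕ,
      algebraMap R _ (f j ^ n) * c τ ∈ I.map (algebraMap R (Localization.Away (prodOf f τ))) := by
    intro τ
    by_cases hj : j ∈ Set.range τ
    · exact ⟨0, Ideal.mul_mem_left _ _ (h0 τ hj)⟩
    · obtain ⟨σ, k, rfl, rfl⟩ := exists_face_eq hj
      have h1 := mem_idealCochain.1 hc σ
      -- All terms of `(d c)_σ` but the one omitting `j` come from components involving `j`, hence
      -- lie in the extension of `I`; so the remaining term does too.
      rw [d_apply, Finset.sum_eq_add_sum_sdiff_singleton_of_mem (Finset.mem_univ k)] at h1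
      have h2 : ∑ m ∈ Finset.univ \ {k}, (-1 : R) ^ (m : ℕ) • res f σ m (c (face σ m)) ∈
          I.map (algebraMap R (Localization.Away (prodOf f σ))) := by
        refine Ideal.sum_mem _ fun m hm => ?_
        rw [Algebra.smul_def]
        refine Ideal.mul_mem_left _ _ (res_mem_map σ m (h0 _ (mem_range_face σ ?_)))
        simpa using hm
      have h3 := (Ideal.add_mem_iff_left _ h2).1 h1
      have h4 : res f σ k (c (face σ k)) ∈
          I.map (algebraMap R (Localization.Away (prodOf f σ))) := by
        rcases neg_one_pow_eq_or R (k : ℕ) with h | h <;> rw [h] at h3 <;> simpa using h3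
      obtain ⟨m, r, hr⟩ := exists_mul_pow_eq (c (face σ k))
      have h5 := congrArg (res f σ k) hr
      rw [map_mul, AlgHom.commutes, AlgHom.commutes] at h5
      have h6 : algebraMap R (Localization.Away (prodOf f σ)) r ∈
          I.map (algebraMap R (Localization.Away (prodOf f σ))) := by
        rw [← h5]
        exact Ideal.mul_mem_right _ _ h4
      obtain ⟨m', hm'⟩ := (mem_map_away_iff (n := 0) (r := r) (by simp)).1 h6
      -- Membership over `σ` means `g_σ ^ m' * r ∈ I`, and `g_σ = f j * g_τ`: the power of `f j`
      -- becomes the multiplier, that of `g_τ` is absorbed over `τ`.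
      refine ⟨m', (mem_map_away_iff (n := m) (r := f (σ k) ^ m' * r) ?_).2 ⟨m', ?_⟩⟩
      · rw [mul_assoc, hr, map_mul]
      · rw [prodOf_eq f σ k, mul_pow] at hm'
        convert hm' using 1
        ring
  choose n hn using key
  refine ⟨Finset.univ.sup n, mem_idealCochain.2 fun τ => ?_⟩
  obtain ⟨k, hk⟩ := Nat.exists_eq_add_of_le (Finset.le_sup (f := n) (Finset.mem_univ τ))
  rw [Pi.smul_apply, Algebra.smul_def, hk, add_comm, pow_add, map_mul, mul_assoc]
  exact Ideal.mul_mem_left _ _ (hn τ)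

include hD

/-- The cohomology modulo `I` is `f j`-power torsion. -/
theorem exists_pow_smul_sub_mem {I : Ideal R} {i : ℕ} {α : ℤ} {c : Cochain f i}
    (hc : c ∈ cochainDegree 𝒜 f i α) (hd : d f i c ∈ idealCochain f I (i + 1)) (j : Fin l) :
    ∃ (n : ℕ), ∃ b ∈ coboundaryDegree 𝒜 f i (α + (n * D j : ℕ)),
      f j ^ n • c - b ∈ idealCochain f I i := by
  obtain ⟨n, b, hb, hbc⟩ := exists_coboundary_eq_at hD hc j
  obtain ⟨m, hm⟩ := exists_pow_smul_mem_idealCochain (I := I) (c := f j ^ n • c - b) j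
    (by
      rw [map_sub, map_smul, d_eq_zero_of_mem_coboundaryDegree hb, sub_zero]
      exact Submodule.smul_mem _ _ hd)
    (fun σ hσ => by
      rw [Pi.sub_apply, hbc σ hσ, sub_self]
      exact zero_mem _)
  refine ⟨m + n, f j ^ m • b, smul_mem_coboundaryDegree hb (SetLike.pow_mem_graded m (hD j)) ?_, ?_⟩
  · push_cast [smul_eq_mul]; ring
  · rwa [pow_add, mul_smul, ← smul_sub]

end Grading

end Cech

end

/-! ### Vanishing in large degrees by Noetherian induction. -/

noncomputable section

namespace Cech

section Vanishing

variable {K : Type v} {R : Type u} [Field K] [CommRing R] [Algebra K R]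
  (𝒜 : ℕ → Submodule K R) [GradedAlgebra 𝒜] {l : ℕ} (f : Fin l → R)

/-- The `i`-th Čech cohomology of `R ⧸ I` vanishes in all large degrees. -/
def VanishesInLargeDegrees (I : Ideal R) (i : ℕ) : Prop :=
  ∃ N : ℤ, ∀ α, N < α → ∀ c ∈ cochainDegree 𝒜 f i α, d f i c ∈ idealCochain f I (i + 1) →
    ∃ b ∈ coboundaryDegree 𝒜 f i α, c - b ∈ idealCochain f I i

variable {𝒜 f} {D : Fin l → ℕ} (hD : ∀ j, f j ∈ 𝒜 (D j))

include hD

/-- Exactness in the middle of the cohomology sequence of `0 → (R ⧸ (I : x))(-b) → R ⧸ I → R ⧸ (I +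
(x)) → 0`, chased on cochains. The shift by `b` accounts for the bound `N₂ + b`. -/
theorem vanishesInLargeDegrees_of_sup_of_colon {I : Ideal R} (hI : I.IsHomogeneous 𝒜) {x : R}
    {b : ℕ} (hx : x ∈ 𝒜 b) {i : ℕ}
    (h₁ : VanishesInLargeDegrees 𝒜 f (I ⊔ Ideal.span {x}) i)
    (h₂ : VanishesInLargeDegrees 𝒜 f (I.colon {x}) i) : VanishesInLargeDegrees 𝒜 f I i := by
  obtain ⟨N₁, h₁⟩ := h₁
  obtain ⟨N₂, h₂⟩ := h₂
  refine ⟨max N₁ (N₂ + b), fun α hα c hc hd => ?_⟩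
  obtain ⟨b₁, hb₁, hcb⟩ := h₁ α (by omega) c hc (idealCochain_mono le_sup_left _ hd)
  obtain ⟨c', hc', hcc'⟩ := exists_sub_smul_mem hD hI hx
    (sub_mem hc (mem_cochainDegree_of_mem_coboundaryDegree hD hb₁)) hcb
  have hd' : d f i c' ∈ idealCochain f (I.colon {x}) (i + 1) := by
    rw [← smul_mem_idealCochain_iff, ← map_smul]
    have := sub_mem hd (d_mem_idealCochain hcc')
    rw [map_sub, map_sub, d_eq_zero_of_mem_coboundaryDegree hb₁, sub_zero, sub_sub_cancel] at this
    exact this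
  obtain ⟨b₂, hb₂, hcb₂⟩ := h₂ (α - b) (by omega) c' hc' hd'
  refine ⟨b₁ + x • b₂, add_mem hb₁ (smul_mem_coboundaryDegree hb₂ hx (by ring)), ?_⟩
  rw [← smul_mem_idealCochain_iff] at hcb₂
  convert add_mem hcc' hcb₂ using 1
  rw [smul_sub]
  abel

/-- If `x` is a nonzerodivisor modulo `I`, multiplication by `x` is injective on the cohomology of
`R ⧸ I` in large degrees. -/
theorem exists_forall_smul_injective {I : Ideal R} (hI : I.IsHomogeneous 𝒜) {x : R}
    {b : ℕ} (hx : x ∈ 𝒜 b) (hcolon : I.colon {x} = I)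
    (h : ∀ i, VanishesInLargeDegrees 𝒜 f (I ⊔ Ideal.span {x}) i) (i : ℕ) :
    ∃ N : ℤ, ∀ α, N < α → ∀ c ∈ cochainDegree 𝒜 f i α,
      (∃ y ∈ coboundaryDegree 𝒜 f i (α + b), x • c - y ∈ idealCochain f I i) →
      ∃ y ∈ coboundaryDegree 𝒜 f i α, c - y ∈ idealCochain f I i := by
  cases i with
  | zero =>
    -- There are no coboundaries in cohomological degree `0`, so injectivity holds in every degree
    -- and the bound is arbitrary.
    refine ⟨0, fun α _ c _ ⟨y, hy, hcy⟩ => ⟨0, zero_mem _, ?_⟩⟩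
    rwa [show y = 0 from hy, sub_zero, smul_mem_idealCochain_iff, hcolon, ← sub_zero c] at hcy
  | succ i =>
    obtain ⟨N, hN⟩ := h i
    refine ⟨N, fun α hα c hc ⟨y, hy, hcy⟩ => ?_⟩
    obtain ⟨z, hz, rfl⟩ := hy
    replace hcy : x • c - d f i z ∈ idealCochain f I (i + 1) := hcy
    have hxc : x • c ∈ idealCochain f (I ⊔ Ideal.span {x}) (i + 1) := by
      refine mem_idealCochain.2 fun σ => ?_
      rw [Pi.smul_apply, Algebra.smul_def]
      exact Ideal.mul_mem_right _ _ (Ideal.mem_map_of_mem _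
        (Ideal.mem_sup_right (Ideal.mem_span_singleton_self x)))
    -- The connecting map: `x • c = d z` modulo `I` makes `z` a cocycle modulo `I + (x)`. Vanishing
    -- there gives `z = w + x • z'` modulo `I` with `w` a coboundary, so `x • (c - d z')` is zero
    -- modulo `I`.
    have hdz : d f i z ∈ idealCochain f (I ⊔ Ideal.span {x}) (i + 1) := by
      simpa using sub_mem hxc (idealCochain_mono le_sup_left _ hcy)
    obtain ⟨w, hw, hzw⟩ := hN (α + b) (by omega) z hz hdz
    obtain ⟨z', hz', hzz'⟩ := exists_sub_smul_mem hD hI hx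
      (sub_mem hz (mem_cochainDegree_of_mem_coboundaryDegree hD hw)) hzw
    rw [add_sub_cancel_right] at hz'
    refine ⟨d f i z', ⟨z', hz', rfl⟩, ?_⟩
    rw [← hcolon, ← smul_mem_idealCochain_iff]
    have := add_mem hcy (d_mem_idealCochain hzz')
    rw [map_sub, map_sub, d_eq_zero_of_mem_coboundaryDegree hw, sub_zero, sub_add_sub_cancel,
      map_smul, ← smul_sub] at this
    exact this

/-- A class killed by a power of `f j` is zero wherever multiplication by `f j` is injective.
Multiplication raises degrees, so it never leaves the range of injectivity. -/
theorem vanishesInLargeDegrees_of_colon_eq {I : Ideal R} (hI : I.IsHomogeneous 𝒜) (j : Fin l)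
    (hcolon : I.colon {f j} = I)
    (h : ∀ i, VanishesInLargeDegrees 𝒜 f (I ⊔ Ideal.span {f j}) i) (i : ℕ) :
    VanishesInLargeDegrees 𝒜 f I i := by
  obtain ⟨N, hN⟩ := exists_forall_smul_injective hD hI (hD j) hcolon h i
  refine ⟨N, fun α hα c hc hd => ?_⟩
  obtain ⟨n, b, hb, hcb⟩ := exists_pow_smul_sub_mem hD hc hd j
  clear hd
  induction n generalizing α c b with
  | zero => exact ⟨b, by simpa using hb, by simpa using hcb⟩
  | succ n ih =>
    refine hN α hα c hc ?_
    refine ih (α + D j) (by omega) (f j • c) (smul_mem_cochainDegree hc (hD j)) b ?_ ?_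
    · convert hb using 2
      push_cast; ring
    · rwa [smul_smul, ← pow_succ]

-- Base case: modulo `I` every localization at a nonempty product is zero, and what is left, `R ⧸
-- I`, has no positive degrees.
omit hD in
theorem vanishesInLargeDegrees_of_irrelevant_le {I : Ideal R} (hf : ∀ j, f j ∈ I)
    (hI : (HomogeneousIdeal.irrelevant 𝒜).toIdeal ≤ I) (i : ℕ) :
    VanishesInLargeDegrees 𝒜 f I i := by
  refine ⟨0, fun α hα c hc _ => ⟨0, zero_mem _, ?_⟩⟩
  rw [sub_zero, mem_idealCochain]
  intro σ
  cases i with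
  | zero =>
    have hp : prodOf f σ = 1 := by simp [prodOf]
    obtain ⟨n, r, hr, hn⟩ := (mem_awayDegree_iff (𝒜 := 𝒜) (E := 0)
      (by rw [hp]; exact SetLike.one_mem_graded 𝒜)).1 (mem_cochainDegree.1 hc σ)
    refine (mem_map_away_iff hn).2 ⟨0, ?_⟩
    rw [pow_zero, one_mul]
    obtain ⟨a, rfl⟩ := Int.eq_ofNat_of_zero_le hα.le
    rw [mul_zero, Nat.cast_zero, add_zero] at hr
    exact hI (HomogeneousIdeal.mem_irrelevant_of_mem 𝒜 (by exact_mod_cast hα) hr)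
  | succ i =>
    have hp : prodOf f σ ∈ I := by
      rw [prodOf_eq f σ 0]
      exact I.mul_mem_right _ (hf _)
    rw [Ideal.eq_top_of_isUnit_mem _ (Ideal.mem_map_of_mem _ hp)
      (IsLocalization.Away.algebraMap_isUnit (S := Localization.Away (prodOf f σ)) (prodOf f σ))]
    trivial

theorem vanishesInLargeDegrees [IsNoetherianRing R]
    (hspan : (HomogeneousIdeal.irrelevant 𝒜).toIdeal ≤ Ideal.span (Set.range f))
    (I : Ideal R) (hI : I.IsHomogeneous 𝒜) (i : ℕ) : VanishesInLargeDegrees 𝒜 f I i := by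
  induction I using WellFoundedGT.induction generalizing i with
  | ind I ih =>
    by_cases hf : ∀ j, f j ∈ I
    · refine vanishesInLargeDegrees_of_irrelevant_le hf (hspan.trans (Ideal.span_le.2 ?_)) i
      rintro _ ⟨j, rfl⟩
      exact hf j
    · push Not at hf
      obtain ⟨j, hj⟩ := hf
      have hsup : ∀ i, VanishesInLargeDegrees 𝒜 f (I ⊔ Ideal.span {f j}) i := by
        refine fun i => ih _ ?_ ?_ i
        · refine lt_of_le_of_ne le_sup_left fun h => hj ?_
          rw [h]
          exact Ideal.mem_sup_right (Ideal.mem_span_singleton_self _)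
        · refine hI.sup (Ideal.homogeneous_span 𝒜 _ ?_)
          rintro _ rfl
          exact ⟨_, hD j⟩
      by_cases hcolon : I.colon {f j} = I
      · exact vanishesInLargeDegrees_of_colon_eq hD hI j hcolon hsup i
      · refine vanishesInLargeDegrees_of_sup_of_colon hD hI (hD j) (hsup i)
          (ih _ (lt_of_le_of_ne ?_ (Ne.symm hcolon)) (isHomogeneous_colon hI (hD j)) i)
        intro y hy
        rw [Submodule.mem_colon_singleton, smul_eq_mul]
        exact I.mul_mem_right _ hy

end Vanishing

end Cech

end

/-! ### Powers of the irrelevant ideal; Frobenius and its splittings on the Čech complex. -/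

noncomputable section

/-- Elements of the `s`-th power of the irrelevant ideal are sums of homogeneous elements of degree
at least `s`. -/
theorem mem_closure_of_mem_irrelevant_pow {K : Type v} {R : Type u} [Field K] [CommRing R]
    [Algebra K R] (𝒜 : ℕ → Submodule K R) [GradedAlgebra 𝒜] (s : ℕ) {y : R}
    (hy : y ∈ (HomogeneousIdeal.irrelevant 𝒜).toIdeal ^ s) :
    y ∈ AddSubmonoid.closure {z : R | ∃ n, s ≤ n ∧ z ∈ 𝒜 n} := by
  classical
  induction s generalizing y with
  | zero =>
    rw [← DirectSum.sum_support_decompose 𝒜 y]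
    exact sum_mem fun n _ => AddSubmonoid.subset_closure ⟨n, Nat.zero_le n, SetLike.coe_mem _⟩
  | succ s ih =>
    rw [pow_succ] at hy
    refine Submodule.mul_induction_on hy (fun a ha b hb => ?_) fun a b => add_mem
    rw [← DirectSum.sum_support_decompose 𝒜 b, Finset.mul_sum]
    refine sum_mem fun n _ => ?_
    by_cases hn : n = 0
    · have h0 : (DirectSum.decompose 𝒜 b 0 : R) = 0 := by
        rw [← GradedRing.proj_apply]
        exact hb
      rw [hn, h0, mul_zero]
      exact zero_mem _
    · replace ha := ih ha
      induction ha using AddSubmonoid.closure_induction with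
      | mem z hz =>
        obtain ⟨m, hm, hz⟩ := hz
        exact AddSubmonoid.subset_closure
          ⟨m + n, by omega, SetLike.mul_mem_graded hz (SetLike.coe_mem _)⟩
      | zero => rw [zero_mul]; exact zero_mem _
      | add z w _ _ hz hw => rw [add_mul]; exact add_mem hz hw

theorem IsStandardGraded.isNoetherianRing {K : Type v} {R : Type u} [Field K] [CommRing R]
    [Algebra K R] {𝒜 : ℕ → Submodule K R} [GradedAlgebra 𝒜] (hR : IsStandardGraded K 𝒜) :
    IsNoetherianRing R := by
  have : Algebra.FiniteType K R := by
    obtain ⟨s, hs⟩ := Module.Finite.iff_fg.1 hR.finite_degree_one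
    refine ⟨s, top_le_iff.1 ?_⟩
    rw [← hR.adjoin_degree_one, ← hs, Algebra.adjoin_span]
  exact Algebra.FiniteType.isNoetherianRing K R

namespace Cech

section Frobenius

variable {R : Type u} [CommRing R] {q : ℕ}

/-- A `q`-inverse linear map extends to localizations. -/
theorem exists_localization_extension (φ : R →+ R) (hφ : ∀ a z, φ (a ^ q * z) = a * φ z)
    (hq : q ≠ 0) (g : R) :
    ∃ ψ : Localization.Away g → Localization.Away g, ∀ z (n : ℕ) r,
      z * algebraMap R (Localization.Away g) (g ^ n) ^ q = algebraMap R _ r →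
      ψ z * algebraMap R (Localization.Away g) (g ^ n) = algebraMap R _ (φ r) := by
  have huniq : ∀ (z : Localization.Away g) (n m : ℕ) (r s : R),
      z * algebraMap R (Localization.Away g) (g ^ n) ^ q = algebraMap R _ r →
      z * algebraMap R (Localization.Away g) (g ^ m) ^ q = algebraMap R _ s →
      algebraMap R (Localization.Away g) (g ^ m * φ r) = algebraMap R _ (g ^ n * φ s) := by
    intro z n m r s h₁ h₂
    have : algebraMap R (Localization.Away g) ((g ^ m) ^ q * r) =
        algebraMap R (Localization.Away g) ((g ^ n) ^ q * s) := by
      rw [map_mul, map_mul, ← h₁, ← h₂, map_pow _ (g ^ m), map_pow _ (g ^ n)]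
      ring
    obtain ⟨k, hk⟩ := algebraMap_eq_iff.1 this
    refine algebraMap_eq_iff.2 ⟨k, ?_⟩
    obtain ⟨q, rfl⟩ := Nat.exists_eq_add_one_of_ne_zero hq
    -- Only `q`-th powers pass through `φ`, so `g ^ k` is moved inside as `(g ^ k) ^ q`; since `q ≥
    -- 1`, it still equalizes the two sides.
    rw [← hφ, ← hφ, ← hφ, ← hφ, pow_succ (g ^ k), mul_assoc, mul_assoc, hk]
  have hex : ∀ z : Localization.Away g, ∃ y : Localization.Away g, ∀ (n : ℕ) r,
      z * algebraMap R (Localization.Away g) (g ^ n) ^ q = algebraMap R _ r →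
      y * algebraMap R (Localization.Away g) (g ^ n) = algebraMap R _ (φ r) := by
    intro z
    obtain ⟨n, r, hr⟩ := exists_mul_pow_eq z
    obtain ⟨q', rfl⟩ := Nat.exists_eq_add_one_of_ne_zero hq
    have hr' : z * algebraMap R (Localization.Away g) (g ^ n) ^ (q' + 1) =
        algebraMap R _ ((g ^ n) ^ q' * r) := by
      rw [map_mul, ← hr, map_pow _ (g ^ n)]; ring
    have hu := isUnit_algebraMap_pow (g := g) n
    -- Rewrite `r / g ^ n` with a `q`-th power as denominator, `(g ^ n) ^ (q - 1) * r / (g ^ n) ^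
    -- q`, and apply `φ` to the numerator.
    refine ⟨algebraMap R _ (φ ((g ^ n) ^ q' * r)) * hu.unit⁻¹, fun m s hs => ?_⟩
    have h := huniq z n m _ s hr' hs
    rw [map_mul (algebraMap R _), map_mul (algebraMap R _)] at h
    rw [← hu.mul_right_inj, ← h, mul_comm (algebraMap R _ (φ _)), ← mul_assoc, ← mul_assoc,
      IsUnit.mul_val_inv, one_mul, mul_comm]
  choose ψ hψ using hex
  exact ⟨ψ, hψ⟩

variable {l : ℕ} {f : Fin l → R}

/-- The componentwise `q`-th power of a cochain. -/
def powCochain (q : ℕ) {i : ℕ} (c : Cochain f i) : Cochain f i := fun σ => c σ ^ q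

theorem pow_mem_intDegree {K : Type v} [Field K] [Algebra K R] {𝒜 : ℕ → Submodule K R}
    [GradedAlgebra 𝒜] {r : R} {α : ℤ} (hr : r ∈ intDegree 𝒜 α) (hq : q ≠ 0) :
    r ^ q ∈ intDegree 𝒜 (q * α) := by
  cases α with
  | ofNat a => exact SetLike.pow_mem_graded (A := 𝒜) q hr
  | negSucc a =>
    rw [show r = 0 from hr, zero_pow hq]
    exact zero_mem _

theorem smul_powCochain_mem_cochainDegree {K : Type v} [Field K] [Algebra K R]
    {𝒜 : ℕ → Submodule K R} [GradedAlgebra 𝒜] {i : ℕ} {α : ℤ} {c : Cochain f i}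
    (hc : c ∈ cochainDegree 𝒜 f i α) (hq : q ≠ 0) {y : R} {n : ℕ} (hy : y ∈ 𝒜 n) :
    y • powCochain q c ∈ cochainDegree 𝒜 f i (q * α + n) := by
  refine smul_mem_cochainDegree (mem_cochainDegree.2 fun σ => ?_) hy
  obtain ⟨m, b, r, hm, hr, hx⟩ := mem_cochainDegree.1 hc σ
  refine ⟨m * q, q * b, r ^ q, ?_, ?_, ?_⟩
  · rw [pow_mul]
    exact SetLike.pow_mem_graded q hm
  · have := pow_mem_intDegree hr hq
    rwa [mul_add, ← Nat.cast_mul] at this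
  · rw [powCochain, map_pow, pow_mul, ← map_pow _ _ m, ← mul_pow, hx, map_pow]

theorem d_powCochain (p e : ℕ) [Fact p.Prime] [CharP R p] {i : ℕ} (c : Cochain f i) :
    d f i (powCochain (p ^ e) c) = powCochain (p ^ e) (d f i c) := by
  funext σ
  rw [powCochain, d_apply, d_apply]
  rcases subsingleton_or_nontrivial (Localization.Away (prodOf f σ)) with h | h
  · exact Subsingleton.elim _ _
  have hp0 : (p : Localization.Away (prodOf f σ)) = 0 := by
    rw [← map_natCast (algebraMap R _), CharP.cast_eq_zero, map_zero]
  -- Needed for additivity of the `q`-th power; the zero localization had to be excluded first.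
  have : CharP (Localization.Away (prodOf f σ)) p := by
    obtain ⟨r, hr⟩ := CharP.exists (Localization.Away (prodOf f σ))
    rcases (Nat.dvd_prime Fact.out).1 ((CharP.cast_eq_zero_iff _ r p).1 hp0) with rfl | rfl
    · exact (CharP.false_of_nontrivial_of_char_one (R := Localization.Away (prodOf f σ))).elim
    · exact hr
  rw [← iterateFrobenius_def, map_sum]
  refine Finset.sum_congr rfl fun k _ => ?_
  have hres : res f σ k (powCochain (p ^ e) c (face σ k)) =
      iterateFrobenius _ p e (res f σ k (c (face σ k))) := by
    rw [powCochain, map_pow, iterateFrobenius_def]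
  rw [hres]
  rcases neg_one_pow_eq_or R (k : ℕ) with h | h <;> rw [h]
  · rw [one_smul, one_smul]
  · rw [neg_one_smul, neg_one_smul, map_neg]

/-- A splitting of `1 ↦ y^{1/q}` gives a retraction on Čech cohomology. -/
theorem mem_coboundaries_of_smul_powCochain_mem (φ : R →+ R)
    (hφ : ∀ a z, φ (a ^ q * z) = a * φ z) (hq : q ≠ 0) {y : R} (hy : φ y = 1) {i : ℕ}
    {c : Cochain f i} (h : y • powCochain q c ∈ coboundaries f i) : c ∈ coboundaries f i := by
  have hex (i : ℕ) (σ : Fin i ↪o Fin l) := exists_localization_extension φ hφ hq (prodOf f σ)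
  choose ψ hψ using hex
  have hψc : ∀ (i : ℕ) (c : Cochain f i) (σ : Fin i ↪o Fin l),
      ψ i σ ((y • powCochain q c) σ) = c σ := by
    intro i c σ
    obtain ⟨n, r, hr⟩ := exists_mul_pow_eq (c σ)
    -- In fractions, `ψ (y * r ^ q / g ^ (n * q)) = r * φ y / g ^ n = r / g ^ n`.
    have h1 := hψ i σ ((y • powCochain q c) σ) n (r ^ q * y) (by
      rw [Pi.smul_apply, Algebra.smul_def, powCochain, mul_assoc, ← mul_pow, hr, map_mul, map_pow,
        mul_comm])
    rw [hφ, hy, mul_one, ← hr] at h1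
    exact (isUnit_algebraMap_pow n).mul_left_inj.1 h1
  have hnum : ∀ (g : R) (z : Localization.Away g), ∃ (n : ℕ) (r : R), ∀ m,
      z * algebraMap R (Localization.Away g) (g ^ (n + m)) ^ q =
        algebraMap R _ ((g ^ m) ^ q * r) := by
    intro g z
    obtain ⟨n, r, hr⟩ := exists_mul_pow_eq z
    obtain ⟨q, rfl⟩ := Nat.exists_eq_add_one_of_ne_zero hq
    refine ⟨n, (g ^ n) ^ q * r, fun m => ?_⟩
    rw [map_mul, map_mul, ← hr, pow_add g, map_mul, map_pow _ (g ^ m), map_pow _ (g ^ n)]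
    ring
  have hψadd : ∀ (i : ℕ) (σ : Fin i ↪o Fin l) (z w), ψ i σ (z + w) = ψ i σ z + ψ i σ w := by
    intro i σ z w
    obtain ⟨n, r, hr⟩ := hnum _ z
    obtain ⟨m, s, hs⟩ := hnum _ w
    replace hr := hr m
    replace hs := hs n
    rw [add_comm m n] at hs
    have h1 := hψ i σ _ _ _ hr
    have h2 := hψ i σ _ _ _ hs
    have h3 := hψ i σ (z + w) (n + m) _ (by rw [add_mul, hr, hs, ← map_add])
    rw [map_add, map_add, ← h1, ← h2, ← add_mul] at h3
    exact (isUnit_algebraMap_pow _).mul_left_inj.1 h3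
  let Ψ (i : ℕ) (σ : Fin i ↪o Fin l) := AddMonoidHom.mk' (ψ i σ) (hψadd i σ)
  have hψres : ∀ (i : ℕ) (σ : Fin (i + 1) ↪o Fin l) (k : Fin (i + 1)) (z),
      Ψ (i + 1) σ (res f σ k z) = res f σ k (Ψ i (face σ k) z) := by
    intro i σ k z
    obtain ⟨n, r, hr⟩ := hnum _ z
    replace hr := hr 0
    rw [pow_zero, one_pow, one_mul, add_zero] at hr
    have hp : prodOf f σ ^ n = f (σ k) ^ n * prodOf f (face σ k) ^ n := by
      rw [prodOf_eq f σ k, mul_pow]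
    have h1 := congrArg (res f σ k) (hψ i _ z n r hr)
    have h2 := congrArg (res f σ k) hr
    rw [map_mul, AlgHom.commutes, AlgHom.commutes] at h1
    rw [map_mul, map_pow, AlgHom.commutes, AlgHom.commutes] at h2
    have h3 := hψ (i + 1) σ (res f σ k z) n ((f (σ k) ^ n) ^ q * r) (by
      rw [hp, map_mul, map_mul, mul_pow, mul_left_comm, h2, map_pow _ (f (σ k) ^ n)])
    rw [hφ, map_mul, ← h1, mul_left_comm, ← map_mul, ← hp] at h3
    exact (isUnit_algebraMap_pow _).mul_left_inj.1 h3
  cases i with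
  | zero =>
    have h0 : y • powCochain q c = 0 := h
    refine (Submodule.mem_bot R).2 (funext fun σ => ?_)
    rw [← hψc _ c σ, h0]
    exact (Ψ 0 σ).map_zero
  | succ i =>
    obtain ⟨b, hb⟩ := h
    -- Since `Ψ` commutes with restriction, applying it to `y • c ^ q = d b` exhibits `c` as the
    -- coboundary of `Ψ b`.
    refine ⟨fun τ => Ψ i τ (b τ), funext fun σ => ?_⟩
    rw [← hψc _ c σ, ← hb, d_apply, d_apply]
    refine Eq.trans ?_ (map_sum (Ψ (i + 1) σ) _ _).symm
    refine Finset.sum_congr rfl fun k _ => ?_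
    rcases neg_one_pow_eq_or R (k : ℕ) with h | h <;> simp [h, hψres]

end Frobenius

end Cech

end

/-! ### The degree bound and the passage to the limit. -/

noncomputable section

namespace Cech

variable {K : Type v} {R : Type u} [Field K] [CommRing R] [Algebra K R]
  {𝒜 : ℕ → Submodule K R} [GradedAlgebra 𝒜] {l : ℕ} {f : Fin l → R}

theorem localCohomologyDegree_eq_bot_iff {i : ℕ} {α : ℤ} :
    localCohomologyDegree 𝒜 f i α = ⊥ ↔
      ∀ c ∈ cochainDegree 𝒜 f i α, d f i c = 0 → c ∈ coboundaries f i := by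
  rw [localCohomologyDegree, AddSubgroup.map_eq_bot_iff]
  constructor
  · intro h c hc hd
    have : (⟨c, hd⟩ : cocycles f i) ∈ ((coboundaries f i).submoduleOf (cocycles f i)).mkQ.ker := h hc
    rw [Submodule.ker_mkQ] at this
    exact this
  · rintro h ⟨c, hd⟩ hc
    refine (Submodule.Quotient.mk_eq_zero _).2 ?_
    exact h c hc hd

theorem exists_forall_localCohomologyDegree_eq_bot [IsNoetherianRing R] {D : Fin l → ℕ}
    (hD : ∀ j, f j ∈ 𝒜 (D j))
    (hspan : (HomogeneousIdeal.irrelevant 𝒜).toIdeal ≤ Ideal.span (Set.range f)) (i : ℕ) :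
    ∃ N : ℤ, ∀ α, N < α → localCohomologyDegree 𝒜 f i α = ⊥ := by
  obtain ⟨N, hN⟩ := vanishesInLargeDegrees hD hspan ⊥ (Ideal.IsHomogeneous.bot 𝒜) i
  refine ⟨N, fun α hα => localCohomologyDegree_eq_bot_iff.2 fun c hc hd => ?_⟩
  obtain ⟨b, hb, hcb⟩ := hN α hα c hc (hd ▸ zero_mem _)
  have : c = b := by
    funext σ
    have := mem_idealCochain.1 hcb σ
    rwa [Ideal.map_bot, Ideal.mem_bot, Pi.sub_apply, sub_eq_zero] at this
  exact this ▸ mem_coboundaries_of_mem_coboundaryDegree hb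

/-- If `1 ↦ y^{1/p^e}` splits for some `y ∈ m^s` and `a` is the top degree of the `i`-th local
cohomology, then `s ≤ -(p^e - 1) a`. -/
theorem le_of_splitting {p e : ℕ} [Fact p.Prime] [CharP R p] {i : ℕ} {a : ℤ}
    (ha : localCohomologyDegree 𝒜 f i a ≠ ⊥)
    (hmax : ∀ α, a < α → localCohomologyDegree 𝒜 f i α = ⊥) {s : ℕ} {y : R}
    (hy : y ∈ (HomogeneousIdeal.irrelevant 𝒜).toIdeal ^ s)
    (φ : FrobRoot p e R →ₗ[R] R) (hφ : φ ∘ₗ FrobRoot.mulRoot p e y = LinearMap.id) :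
    (s : ℤ) ≤ -((p : ℤ) ^ e - 1) * a := by
  by_contra! hs
  have hq : p ^ e ≠ 0 := pow_ne_zero _ (Fact.out : p.Prime).ne_zero
  rw [Ne, localCohomologyDegree_eq_bot_iff] at ha
  push Not at ha
  obtain ⟨c, hc, hd, hcb⟩ := ha
  refine hcb (mem_coboundaries_of_smul_powCochain_mem (q := p ^ e) (y := y)
    (φ.toAddMonoidHom.comp (FrobRoot.root p e).toAddMonoidHom) (fun r z => ?_) hq ?_ ?_)
  · exact φ.map_smul r (FrobRoot.root p e z)
  · have := LinearMap.congr_fun hφ 1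
    simpa [FrobRoot.mulRoot] using this
  · have hy' := mem_closure_of_mem_irrelevant_pow 𝒜 s hy
    clear hφ hy
    -- Coboundaries are closed under sums, so it suffices to treat a form `z` of degree `n ≥ s`,
    -- where `q * a + n > a` forces vanishing.
    induction hy' using AddSubmonoid.closure_induction with
    | mem z hz =>
      obtain ⟨n, hn, hz⟩ := hz
      refine localCohomologyDegree_eq_bot_iff.1 (hmax _ ?_) _
        (smul_powCochain_mem_cochainDegree hc hq hz) ?_
      · push_cast
        linarith [(Nat.cast_le (α := ℤ)).2 hn]
      · rw [map_smul, d_powCochain, hd]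
        funext σ
        simp only [Pi.smul_apply, powCochain, Pi.zero_apply]
        rw [zero_pow hq, smul_zero]
    | zero => rw [zero_smul]; exact zero_mem _
    | add z w _ _ hz hw => rw [add_smul]; exact add_mem hz hw

end Cech

theorem le_neg_of_eventually_floor_le {p : ℕ} (hp : 1 < p) {t a : ℝ}
    (h : ∀ᶠ e : ℕ in Filter.atTop, (⌊((p : ℝ) ^ e - 1) * t⌋₊ : ℝ) ≤ -((p : ℝ) ^ e - 1) * a) :
    t ≤ -a := by
  by_contra! hlt
  have hδ : 0 < t + a := by linarith
  have hp' : (1 : ℝ) < p := by exact_mod_cast hp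
  -- The floor costs less than `1`, so the hypothesis gives `(p ^ e - 1) * (t + a) < 1`; `e` is
  -- chosen large enough to contradict this.
  obtain ⟨e, he, he'⟩ := (h.and ((tendsto_pow_atTop_atTop_of_one_lt hp').eventually_ge_atTop
    (1 / (t + a) + 1))).exists
  have h1 := Nat.lt_floor_add_one (((p : ℝ) ^ e - 1) * t)
  have h2 : 1 ≤ ((p : ℝ) ^ e - 1) * (t + a) := by
    rw [← div_le_iff₀ hδ]
    linarith
  nlinarith

end
/-- For an `F`-finite, `F`-pure standard graded `K`-algebra `R` with irrelevant ideal `m`,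
`fpt(m) ≤ -a_i(R)` for every `i`. The local cohomology with support in `m` is computed by the Čech
complex on an arbitrary finite family `f` of homogeneous elements generating `m`. -/
theorem theorem4p3 {K : Type v} {R : Type u} [Field K] [CommRing R] [Algebra K R]
    (𝒜 : ℕ → Submodule K R) [GradedAlgebra 𝒜] (hR : IsStandardGraded K 𝒜)
    (p : ℕ) [Fact p.Prime] [CharP R p] (hfin : IsFFinite p R) (hpure : IsFPure p R)
    {l : ℕ} (f : Fin l → R) (hf : ∀ j, SetLike.IsHomogeneousElem 𝒜 (f j))
    (hspan : Ideal.span (Set.range f) = (HomogeneousIdeal.irrelevant 𝒜).toIdeal) (i : ℕ) :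
    fpt p (HomogeneousIdeal.irrelevant 𝒜).toIdeal ≤ -Cech.aInvariant 𝒜 f i := by
  have := hR.isNoetherianRing
  choose D hD using hf
  obtain ⟨N, hN⟩ := Cech.exists_forall_localCohomologyDegree_eq_bot hD hspan.ge i
  by_cases hne : ∃ α, Cech.localCohomologyDegree 𝒜 f i α ≠ ⊥
  · obtain ⟨a, ha, hmax⟩ := Int.exists_greatest_of_bdd
      ⟨N, fun α hα => not_lt.1 fun h => hα (hN α h)⟩ hne
    have hle : Cech.aInvariant 𝒜 f i ≤ ((a : ℝ) : EReal) := by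
      refine sSup_le ?_
      rintro _ ⟨α, hα, rfl⟩
      exact EReal.coe_le_coe_iff.2 (Int.cast_le.2 (hmax α hα))
    refine le_trans (sSup_le ?_) (EReal.neg_le_neg_iff.2 hle)
    rintro _ ⟨t, ⟨-, ht⟩, rfl⟩
    rw [← EReal.coe_neg, EReal.coe_le_coe_iff]
    refine le_neg_of_eventually_floor_le (Fact.out : p.Prime).one_lt (ht.mono ?_)
    rintro e ⟨y, hy, φ, hφ⟩
    exact_mod_cast Cech.le_of_splitting ha
      (fun α hα => not_not.1 fun h => (hmax α h).not_gt hα) hy φ hφ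
  -- With no nonzero degree the invariant is `⊥`, and the bound becomes `⊤`.
  · push Not at hne
    have : Cech.aInvariant 𝒜 f i = ⊥ := by
      rw [Cech.aInvariant]
      simp [hne]
    rw [this, EReal.neg_bot]
    exact le_top
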